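/- Let $\mu_{\mathrm{data}}$ be a Borel probability measure on $\mathbb{R}^d$ with finite second moment, $\int \|x\|^2\,\mathrm{d}\mu_{\mathrm{data}}(x)<\infty$. Let $(X_t)_{t\ge 0}$ be a standard $d$-dimensional Brownian motion with initial distribution $X_0\sim\mu_{\mathrm{data}}$, and for $T>0$ let $p_T$ be the law of $X_T$. Let $c_1,\dots,c_d$ be the eigenvalues, with multiplicity, of the covariance matrix $\mathrm{Cov}(\mu_{\mathrm{data}})$, and let $\mu_{\mathrm{prior}}^T=\mathcal{N}(m,\,C_T)$ be the normal distribution with mean $m=\int x\,\mathrm{d}\mu_{\mathrm{data}}(x)$ and covariance matrix $C_T=\mathrm{Cov}(\mu_{\mathrm{data}})+T I_d$. Then for every $T>0$ the Kullback--Leibler divergence of $p_T$ from $\mu_{\mathrm{prior}}^T$ is finite and satisfies $$\mathrm{KL}(p_T\,|\,\mu_{\mathrm{prior}}^T)\;\le\;\frac12\log\left(\frac{\prod_{i=1}^d (c_i+T)}{T^d}\right),$$ where $\mathrm{KL}(p\,|\,q)=\int \log\frac{\mathrm{d}p}{\mathrm{d}q}\,\mathrm{d}p$ if $p\ll q$,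 and $+\infty$ otherwise. -/

import Mathlib

open MeasureTheory ProbabilityTheory
open scoped NNReal

namespace KLBrownian

/-- A `d`-dimensional standard Brownian motion `X` on the probability space `(Ω, P)`, with initial
distribution `μ`: `X 0` has law `μ`; for `s ≤ t` the increment `X t - X s` is Gaussian with mean
zero and covariance `(t - s) I_d`, and is independent of the past `(X r, r ≤ s)`; almost all paths
are continuous. -/
structure IsBrownianMotionFrom {d : ℕ} {Ω : Type*} [MeasurableSpace Ω]
    (X : ℝ≥0 → Ω → EuclideanSpace ℝ (Fin d)) (μ : Measure (EuclideanSpace ℝ (Fin d)))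
    (P : Measure Ω) : Prop where
  initial_law : HasLaw (X 0) μ P
  increment_law : ∀ s t : ℝ≥0, s ≤ t →
    HasLaw (fun ω => X t ω - X s ω)
      (multivariateGaussian 0 (((t : ℝ) - (s : ℝ)) • (1 : Matrix (Fin d) (Fin d) ℝ))) P
  increment_indep : ∀ s t : ℝ≥0, s ≤ t →
    IndepFun (fun ω => X t ω - X s ω) (fun ω (r : Set.Iic s) => X r ω) P
  continuous_paths : ∀ᵐ ω ∂P, Continuous fun t => X t ω

/-- The covariance matrix of a measure on `ℝ^d`, with entries `Cov(x_i, x_j)`. -/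
noncomputable def covarianceMatrix {d : ℕ} (μ : Measure (EuclideanSpace ℝ (Fin d))) :
    Matrix (Fin d) (Fin d) ℝ :=
  Matrix.of fun i j => cov[fun x => x i, fun x => x j; μ]

theorem covarianceMatrix_isHermitian {d : ℕ} (μ : Measure (EuclideanSpace ℝ (Fin d))) :
    (covarianceMatrix μ).IsHermitian := by
  ext i j
  simp [covarianceMatrix, covariance_comm]

/-- The eigenvalues `c_1, …, c_d` of the covariance matrix, repeated with multiplicity. -/
noncomputable def covarianceEigenvalues {d : ℕ} (μ : Measure (EuclideanSpace ℝ (Fin d))) :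
    Fin d → ℝ :=
  (covarianceMatrix_isHermitian μ).eigenvalues

end KLBrownian

open scoped ENNReal

namespace KLBrownian

open scoped RealInnerProductSpace Matrix

/-! Write `X T = X 0 + Z` with `Z ∼ N(0, T I)` independent of `X 0`. By data processing
(`klDiv_map_le`), forgetting `X 0` cannot increase the divergence, so it suffices to compare the
joint law of `(X 0, X T)` with `μ_data ⊗ prior`. That divergence is computed exactly in
`klDiv_map_prod_pi_gaussianReal`. In an eigenbasis of the covariance matrix both `N(x, T I)` and the
prior are products, so the log density is a sum over coordinates of `1/2 log((c_i + T)/T)` plus a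
difference of two quadratic terms. The prior has the mean and variances of `X T`, so each quadratic
term has expectation `1/2` and they cancel. -/

theorem pi_withDensity {ι : Type*} [Fintype ι] {α : ι → Type*} [∀ i, MeasurableSpace (α i)]
    (ν : ∀ i, Measure (α i)) [∀ i, IsProbabilityMeasure (ν i)] {r : ∀ i, α i → ℝ≥0∞}
    (hr : ∀ i, Measurable (r i)) [∀ i, SigmaFinite ((ν i).withDensity (r i))] :
    Measure.pi (fun i => (ν i).withDensity (r i)) =
      (Measure.pi ν).withDensity (fun y => ∏ i, r i (y i)) := by
  refine Measure.pi_eq fun s hs => ?_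
  have hms := MeasurableSet.univ_pi hs
  -- Under a product measure the coordinates are independent, so the integral of the product density
  -- over a box factors.
  have hind : iIndepFun (fun i (y : ∀ i, α i) => (s i).indicator (r i) (y i)) (Measure.pi ν) :=
    iIndepFun_pi (X := fun i => (s i).indicator (r i))
      fun i => ((hr i).indicator (hs i)).aemeasurable
  rw [withDensity_apply _ hms, ← lintegral_indicator hms]
  calc _ = ∫⁻ y, ∏ i, (s i).indicator (r i) (y i) ∂Measure.pi ν := by
        refine lintegral_congr fun y => ?_
        by_cases hy : y ∈ Set.univ.pi s
        · rw [Set.indicator_of_mem hy]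
          exact Finset.prod_congr rfl fun i _ => (Set.indicator_of_mem (hy i trivial) _).symm
        · rw [Set.indicator_of_notMem hy]
          obtain ⟨i, hi⟩ : ∃ i, y i ∉ s i := by simpa [Set.mem_pi] using hy
          exact (Finset.prod_eq_zero (Finset.mem_univ i) (Set.indicator_of_notMem hi _)).symm
    _ = ∏ i, ∫⁻ y, (s i).indicator (r i) (y i) ∂Measure.pi ν :=
        lintegral_prod_eq_prod_lintegral_of_indepFun Finset.univ _ hind fun i =>
          ((hr i).indicator (hs i)).comp (measurable_pi_apply i)
    _ = _ := by
        refine Finset.prod_congr rfl fun i _ => ?_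
        rw [(measurePreserving_eval ν i).lintegral_comp ((hr i).indicator (hs i)),
          lintegral_indicator (hs i), withDensity_apply _ (hs i)]

/-- The density of `N(a, t)` with respect to `N(m, v)`. -/
noncomputable def gaussianRatio (t : ℝ≥0) (m : ℝ) (v : ℝ≥0) (a y : ℝ) : ℝ :=
  gaussianPDFReal a t y / gaussianPDFReal m v y

theorem gaussianRatio_pos {t v : ℝ≥0} (ht : t ≠ 0) (hv : v ≠ 0) (m a y : ℝ) :
    0 < gaussianRatio t m v a y :=
  div_pos (gaussianPDFReal_pos _ _ _ ht) (gaussianPDFReal_pos _ _ _ hv)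

@[fun_prop]
theorem measurable_gaussianRatio (t : ℝ≥0) (m : ℝ) (v : ℝ≥0) :
    Measurable (fun p : ℝ × ℝ => gaussianRatio t m v p.1 p.2) := by
  unfold gaussianRatio gaussianPDFReal
  fun_prop

theorem log_gaussianPDFReal {v : ℝ≥0} (hv : v ≠ 0) (m y : ℝ) :
    Real.log (gaussianPDFReal m v y) =
      -(1 / 2 * Real.log (2 * Real.pi * v)) - (y - m) ^ 2 / (2 * v) := by
  have hv' : (0 : ℝ) < v := by positivity
  have : (0 : ℝ) < 2 * Real.pi * v := by positivity
  rw [gaussianPDFReal, Real.log_mul (by positivity) (Real.exp_ne_zero _), Real.log_exp,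
    Real.log_inv, Real.log_sqrt this.le]
  ring

theorem log_gaussianRatio {t v : ℝ≥0} (ht : t ≠ 0) (hv : v ≠ 0) (m a y : ℝ) :
    Real.log (gaussianRatio t m v a y) =
      1 / 2 * Real.log (v / t) + ((y - m) ^ 2 / (2 * v) - (y - a) ^ 2 / (2 * t)) := by
  have hv' : (v : ℝ) ≠ 0 := by simpa
  have ht' : (t : ℝ) ≠ 0 := by simpa
  have hp : 2 * Real.pi ≠ 0 := by positivity
  rw [gaussianRatio, Real.log_div (gaussianPDFReal_pos _ _ _ ht).ne'
    (gaussianPDFReal_pos _ _ _ hv).ne', log_gaussianPDFReal ht, log_gaussianPDFReal hv,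
    Real.log_div hv' ht', Real.log_mul hp hv', Real.log_mul hp ht']
  ring

theorem gaussianReal_eq_withDensity_gaussianRatio {t v : ℝ≥0} (ht : t ≠ 0) (hv : v ≠ 0)
    (m a : ℝ) :
    gaussianReal a t =
      (gaussianReal m v).withDensity (fun y => ENNReal.ofReal (gaussianRatio t m v a y)) := by
  rw [gaussianReal_of_var_ne_zero _ ht, gaussianReal_of_var_ne_zero _ hv,
    ← withDensity_mul _ (measurable_gaussianPDF _ _) (by unfold gaussianRatio; fun_prop)]
  congr 1
  ext y
  have h := gaussianPDFReal_pos m v y hv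
  simp only [Pi.mul_apply, gaussianPDF, gaussianRatio]
  rw [← ENNReal.ofReal_mul h.le, mul_div_cancel₀ _ h.ne']

theorem pi_gaussianReal_eq_withDensity {ι : Type*} [Fintype ι] {t : ℝ≥0} (ht : t ≠ 0)
    {v : ι → ℝ≥0} (hv : ∀ i, v i ≠ 0) (m a : ι → ℝ) :
    Measure.pi (fun i => gaussianReal (a i) t) =
      (Measure.pi fun i => gaussianReal (m i) (v i)).withDensity
        (fun y => ENNReal.ofReal (∏ i, gaussianRatio t (m i) (v i) (a i) (y i))) := by
  have h i := gaussianReal_eq_withDensity_gaussianRatio ht (hv i) (m i) (a i)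
  have : ∀ i, SigmaFinite ((gaussianReal (m i) (v i)).withDensity
      (fun y => ENNReal.ofReal (gaussianRatio t (m i) (v i) (a i) y))) := fun i => by
    rw [← h i]; infer_instance
  simp_rw [h, ENNReal.ofReal_prod_of_nonneg
    fun i _ => (gaussianRatio_pos ht (hv i) (m i) (a i) _).le]
  exact pi_withDensity _ fun i => by fun_prop

/-- The joint law of a random signal `a` and its observation with independent Gaussian noise has an
explicit density with respect to the product of the signal law and any Gaussian product law. -/
theorem map_prod_pi_gaussianReal_eq_withDensity {ι E : Type*} [Fintype ι] [MeasurableSpace E]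
    (μ : Measure E) [IsProbabilityMeasure μ] {a : E → ι → ℝ} (ha : Measurable a)
    {t : ℝ≥0} (ht : t ≠ 0) {v : ι → ℝ≥0} (hv : ∀ i, v i ≠ 0) (m : ι → ℝ) :
    (μ.prod (Measure.pi fun _ : ι => gaussianReal 0 t)).map (fun p => (p.1, a p.1 + p.2)) =
      (μ.prod (Measure.pi fun i => gaussianReal (m i) (v i))).withDensity
        (fun p => ENNReal.ofReal (∏ i, gaussianRatio t (m i) (v i) (a p.1 i) (p.2 i))) := by
  refine Measure.ext_of_lintegral _ fun f hf => ?_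
  have hr : Measurable (fun p : E × (ι → ℝ) =>
      ENNReal.ofReal (∏ i, gaussianRatio t (m i) (v i) (a p.1 i) (p.2 i))) := by
    fun_prop
  rw [lintegral_map hf (by fun_prop), lintegral_prod _ (by fun_prop),
    lintegral_withDensity_eq_lintegral_mul _ hr hf, lintegral_prod _ (by fun_prop)]
  refine lintegral_congr fun x => ?_
  -- With the signal `x` fixed, the observation is a product of the laws `N(a x i, t)`.
  have hmap : (Measure.pi fun _ : ι => gaussianReal 0 t).map (fun z => a x + z) =
      Measure.pi (fun i => gaussianReal (a x i) t) := by
    have := Measure.pi_map_pi (μ := fun _ : ι => gaussianReal 0 t)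
      (f := fun i z => a x i + z) (fun i => by fun_prop)
    simp only [gaussianReal_map_const_add, zero_add] at this
    exact this
  rw [← lintegral_map (f := fun y => f (x, y)) (g := fun z => a x + z) (by fun_prop)
    (by fun_prop), hmap, pi_gaussianReal_eq_withDensity ht hv m,
    lintegral_withDensity_eq_lintegral_mul _ (by fun_prop) (by fun_prop)]
  rfl

/-! ### Exact divergence of the joint law -/

theorem klDiv_withDensity_eq {α : Type*} [MeasurableSpace α] {μ ν : Measure α}
    [IsProbabilityMeasure μ] [IsProbabilityMeasure ν] {r : α → ℝ} (hr : Measurable r)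
    (h0 : ∀ x, 0 ≤ r x) (hμ : μ = ν.withDensity fun x => ENNReal.ofReal (r x))
    (hint : Integrable (fun x => Real.log (r x)) μ) :
    InformationTheory.klDiv μ ν = ENNReal.ofReal (∫ x, Real.log (r x) ∂μ) := by
  have hac : μ ≪ ν := hμ ▸ withDensity_absolutelyContinuous _ _
  have hllr : llr μ ν =ᵐ[μ] fun x => Real.log (r x) := by
    have h := ν.rnDeriv_withDensity hr.ennreal_ofReal
    rw [← hμ] at h
    filter_upwards [hac.ae_le h] with x hx
    rw [llr, hx, ENNReal.toReal_ofReal (h0 x)]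
  rw [InformationTheory.klDiv_of_ac_of_integrable hac ((integrable_congr hllr).2 hint),
    integral_congr_ae hllr]
  simp

/-- `v i` is the variance of signal plus noise in coordinate `i`; this choice makes the quadratic
terms cancel in expectation. -/
theorem klDiv_map_prod_pi_gaussianReal {ι E : Type*} [Fintype ι] [MeasurableSpace E]
    (μ : Measure E) [IsProbabilityMeasure μ] {a : E → ι → ℝ} (ha : Measurable a)
    (ha2 : ∀ i, MemLp (fun x => a x i) 2 μ)
    {t : ℝ≥0} (ht : t ≠ 0) {v : ι → ℝ≥0} (hv : ∀ i, (v i : ℝ) = Var[fun x => a x i; μ] + t) :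
    InformationTheory.klDiv
        ((μ.prod (Measure.pi fun _ : ι => gaussianReal 0 t)).map (fun p => (p.1, a p.1 + p.2)))
        (μ.prod (Measure.pi fun i => gaussianReal (∫ x, a x i ∂μ) (v i))) =
      ENNReal.ofReal (∑ i, 1 / 2 * Real.log (v i / t)) := by
  have hv0 : ∀ i, v i ≠ 0 := fun i => by
    have h1 := variance_nonneg (fun x => a x i) μ
    have h2 : (0 : ℝ) < t := by positivity
    have h3 : (0 : ℝ) < v i := by rw [hv i]; linarith
    exact_mod_cast h3.ne'
  set m : ι → ℝ := fun i => ∫ x, a x i ∂μ with hm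
  set γ : Measure (ι → ℝ) := Measure.pi fun _ => gaussianReal 0 t with hγ
  have hφ : Measurable (fun p : E × (ι → ℝ) => (p.1, a p.1 + p.2)) := by fun_prop
  have : IsProbabilityMeasure ((μ.prod γ).map (fun p => (p.1, a p.1 + p.2))) :=
    Measure.isProbabilityMeasure_map hφ.aemeasurable
  have hr : Measurable (fun p : E × (ι → ℝ) =>
      ∏ i, gaussianRatio t (m i) (v i) (a p.1 i) (p.2 i)) := by
    fun_prop
  have hz2 : ∀ i, MemLp (fun z : ι → ℝ => z i) 2 γ := fun i =>
    (IsGaussian.memLp_two_id (μ := gaussianReal 0 t)).comp_measurePreserving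
      (measurePreserving_eval (fun _ : ι => gaussianReal 0 t) i)
  have hzint : ∀ i, ∫ z, z i ∂γ = 0 := fun i => by
    rw [hγ, integral_eval]
    simp
  have hzvar : ∀ i, Var[fun z : ι → ℝ => z i; γ] = t := fun i => by
    have h := variance_map (μ := γ) (X := id) (Y := fun z : ι → ℝ => z i)
      aemeasurable_id (measurable_pi_apply i).aemeasurable
    rw [(measurePreserving_eval (fun _ : ι => gaussianReal 0 t) i).map_eq,
      variance_id_gaussianReal] at h
    exact h.symm
  have hafst : ∀ i, MemLp (fun p : E × (ι → ℝ) => a p.1 i) 2 (μ.prod γ) := fun i =>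
    (ha2 i).comp_measurePreserving measurePreserving_fst
  have hzsnd : ∀ i, MemLp (fun p : E × (ι → ℝ) => p.2 i) 2 (μ.prod γ) := fun i =>
    (hz2 i).comp_measurePreserving measurePreserving_snd
  have hW2 : ∀ i, MemLp (fun p : E × (ι → ℝ) => a p.1 i + p.2 i) 2 (μ.prod γ) := fun i =>
    (hafst i).add (hzsnd i)
  have hWmean : ∀ i, ∫ p, (a p.1 i + p.2 i) ∂μ.prod γ = m i := fun i => by
    rw [integral_add ((hafst i).integrable (by norm_num)) ((hzsnd i).integrable (by norm_num)),
      integral_fun_fst (fun x => a x i), integral_fun_snd (fun z : ι → ℝ => z i), hzint i]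
    simp [hm]
  have hWvar : ∀ i, ∫ p, (a p.1 i + p.2 i - m i) ^ 2 ∂μ.prod γ = v i := fun i => by
    have h := variance_eq_integral (hW2 i).aemeasurable
    rw [hWmean i] at h
    rw [← h, variance_add_prod (ha2 i) (hz2 i), hzvar i, hv i]
  have hzsq : ∀ i, ∫ p : E × (ι → ℝ), p.2 i ^ 2 ∂μ.prod γ = t := fun i => by
    rw [integral_fun_snd (fun z : ι → ℝ => z i ^ 2),
      ← variance_of_integral_eq_zero (hz2 i).aemeasurable (hzint i), hzvar i]
    simp
  have hWint : ∀ i, Integrable (fun p : E × (ι → ℝ) =>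
      (a p.1 i + p.2 i - m i) ^ 2 / (2 * v i)) (μ.prod γ) := fun i =>
    (((hW2 i).sub (memLp_const (m i))).integrable_sq).div_const _
  have hzint2 : ∀ i, Integrable (fun p : E × (ι → ℝ) => p.2 i ^ 2 / (2 * t)) (μ.prod γ) :=
    fun i => (hzsnd i).integrable_sq.div_const _
  -- Along the pushforward, observation minus signal is the noise `p.2`.
  have hlog : ∀ p : E × (ι → ℝ),
      Real.log (∏ i, gaussianRatio t (m i) (v i) (a p.1 i) ((a p.1 + p.2) i)) =
        ∑ i, (1 / 2 * Real.log (v i / t) +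
          ((a p.1 i + p.2 i - m i) ^ 2 / (2 * v i) - p.2 i ^ 2 / (2 * t))) := fun p => by
    rw [Real.log_prod fun i _ => (gaussianRatio_pos ht (hv0 i) _ _ _).ne']
    refine Finset.sum_congr rfl fun i _ => ?_
    rw [log_gaussianRatio ht (hv0 i), Pi.add_apply, add_sub_cancel_left]
  have hterm : ∀ i, Integrable (fun p : E × (ι → ℝ) => 1 / 2 * Real.log (v i / t) +
      ((a p.1 i + p.2 i - m i) ^ 2 / (2 * v i) - p.2 i ^ 2 / (2 * t))) (μ.prod γ) := fun i =>
    (integrable_const _).add ((hWint i).sub (hzint2 i))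
  have hlm : AEStronglyMeasurable (fun p : E × (ι → ℝ) =>
      Real.log (∏ i, gaussianRatio t (m i) (v i) (a p.1 i) (p.2 i)))
      ((μ.prod γ).map (fun p => (p.1, a p.1 + p.2))) :=
    hr.log.aestronglyMeasurable
  rw [klDiv_withDensity_eq hr
    (fun p => Finset.prod_nonneg fun i _ => (gaussianRatio_pos ht (hv0 i) _ _ _).le)
    (map_prod_pi_gaussianReal_eq_withDensity μ ha ht hv0 m) ?_, integral_map hφ.aemeasurable hlm]
  · congr 1
    simp_rw [hlog]
    rw [integral_finsetSum _ fun i _ => hterm i]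
    refine Finset.sum_congr rfl fun i _ => ?_
    rw [integral_add (integrable_const _) (by exact (hWint i).sub (hzint2 i)),
      integral_sub (hWint i) (hzint2 i), integral_div, integral_div, hWvar i, hzsq i]
    have h1 : (v i : ℝ) ≠ 0 := by simpa using hv0 i
    have h2 : (t : ℝ) ≠ 0 := by simpa using ht
    simp
    field_simp
    ring
  · rw [integrable_map_measure hlm hφ.aemeasurable]
    simp only [Function.comp_def, hlog]
    exact integrable_finsetSum _ fun i _ => hterm i

/-! ### Diagonalisation of Gaussians and covariance matrices -/

/-- In an orthonormal basis of eigenvectors of its covariance matrix, a multivariate Gaussian has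
independent Gaussian coordinates. -/
theorem map_pi_gaussianReal_eq_multivariateGaussian {ι κ : Type*} [Fintype ι] [DecidableEq ι]
    [Fintype κ] (b : OrthonormalBasis κ ℝ (EuclideanSpace ℝ ι)) (m : EuclideanSpace ℝ ι)
    {S : Matrix ι ι ℝ} (hS : S.PosSemidef) {v : κ → ℝ≥0}
    (hv : ∀ k, S *ᵥ (b k).ofLp = (v k : ℝ) • (b k).ofLp) :
    (Measure.pi fun k => gaussianReal ⟪b k, m⟫ (v k)).map (fun y => ∑ k, y k • b k) =
      multivariateGaussian m S := by
  have hmeas : Measurable (fun y : κ → ℝ => ∑ k, y k • b k) := by fun_prop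
  have : IsProbabilityMeasure ((Measure.pi fun k => gaussianReal ⟪b k, m⟫ (v k)).map
      (fun y => ∑ k, y k • b k)) := Measure.isProbabilityMeasure_map hmeas.aemeasurable
  -- The characteristic function of the product factors; its exponents sum to the linear and
  -- quadratic forms of `m` and `S` expanded in `b`.
  refine Measure.ext_of_charFun (funext fun x => ?_)
  rw [charFun_multivariateGaussian hS, charFun_apply, integral_map hmeas.aemeasurable
    (Measurable.aestronglyMeasurable (by fun_prop))]
  simp_rw [sum_inner, Complex.ofReal_sum, Finset.sum_mul, Complex.exp_sum,
    integral_fintype_prod_eq_prod (f := fun k y => Complex.exp (⟪y • b k, x⟫ * Complex.I)),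
    real_inner_smul_left, mul_comm _ (⟪_, _⟫), Complex.ofReal_mul, ← charFun_apply_real,
    charFun_gaussianReal]
  rw [← Complex.exp_sum]
  have hmean : ⟪x, m⟫ = ∑ k, ⟪b k, x⟫ * ⟪b k, m⟫ := by
    rw [← b.sum_inner_mul_inner x m]
    simp_rw [real_inner_comm x]
  have hquad : x.ofLp ⬝ᵥ S *ᵥ x.ofLp = ∑ k, v k * ⟪b k, x⟫ ^ 2 := by
    have hx : S *ᵥ x.ofLp = ∑ k, (⟪b k, x⟫ * v k) • (b k).ofLp := by
      conv_lhs => rw [← b.sum_repr' x]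
      simp [Matrix.mulVec_sum, Matrix.mulVec_smul, hv, smul_smul]
    rw [hx, dotProduct_sum]
    refine Finset.sum_congr rfl fun k _ => ?_
    have : x.ofLp ⬝ᵥ (b k).ofLp = ⟪b k, x⟫ := by
      rw [EuclideanSpace.inner_eq_star_dotProduct]; simp
    rw [dotProduct_smul, this, smul_eq_mul]
    ring
  rw [hmean, hquad]
  congr 1
  push_cast
  rw [Finset.sum_mul, Finset.sum_div, ← Finset.sum_sub_distrib]

theorem dotProduct_covarianceMatrix_mulVec {d : ℕ} {μ : Measure (EuclideanSpace ℝ (Fin d))}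
    [IsProbabilityMeasure μ] (hμ : MemLp (fun x => x) 2 μ) (u : EuclideanSpace ℝ (Fin d)) :
    u.ofLp ⬝ᵥ covarianceMatrix μ *ᵥ u.ofLp = Var[fun x => ⟪u, x⟫; μ] := by
  have hi : ∀ i, MemLp (fun x : EuclideanSpace ℝ (Fin d) => x i) 2 μ := fun i =>
    (EuclideanSpace.proj (𝕜 := ℝ) i).comp_memLp' hμ
  have h := covarianceBilin_apply_pi hi u u
  have hid : μ.map (fun x => WithLp.toLp 2 (fun i => x i)) = μ := Measure.map_id
  rw [hid, covarianceBilin_self hμ] at h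
  rw [h]
  simp only [dotProduct, Matrix.mulVec, covarianceMatrix, Matrix.of_apply, Finset.mul_sum]
  exact Finset.sum_congr rfl fun i _ => Finset.sum_congr rfl fun j _ => by ring

theorem covarianceMatrix_posSemidef {d : ℕ} {μ : Measure (EuclideanSpace ℝ (Fin d))}
    [IsProbabilityMeasure μ] (hμ : MemLp (fun x => x) 2 μ) :
    (covarianceMatrix μ).PosSemidef :=
  .of_dotProduct_mulVec_nonneg (covarianceMatrix_isHermitian μ) fun x => by
    have h := dotProduct_covarianceMatrix_mulVec hμ (WithLp.toLp 2 x)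
    simp [h, variance_nonneg]

theorem variance_inner_eigenvectorBasis {d : ℕ} {μ : Measure (EuclideanSpace ℝ (Fin d))}
    [IsProbabilityMeasure μ] (hμ : MemLp (fun x => x) 2 μ) (i : Fin d) :
    Var[fun x => ⟪(covarianceMatrix_isHermitian μ).eigenvectorBasis i, x⟫; μ] =
      covarianceEigenvalues μ i := by
  rw [← dotProduct_covarianceMatrix_mulVec hμ, covarianceEigenvalues,
    Matrix.IsHermitian.eigenvalues_eq]
  simp

/-! ### Law of `X T` and the final bound -/

/-- The law of Brownian motion at time `t` is the initial law convolved with `N(0, t I)`. -/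
theorem IsBrownianMotionFrom.map_eq_map_add {d : ℕ} {Ω : Type*} [MeasurableSpace Ω]
    {X : ℝ≥0 → Ω → EuclideanSpace ℝ (Fin d)} {μ : Measure (EuclideanSpace ℝ (Fin d))}
    {P : Measure Ω} [IsProbabilityMeasure P] (hX : IsBrownianMotionFrom X μ P) (t : ℝ≥0) :
    P.map (X t) = (μ.prod (multivariateGaussian 0
      ((t : ℝ) • (1 : Matrix (Fin d) (Fin d) ℝ)))).map (fun p => p.1 + p.2) := by
  have h0 := hX.initial_law
  have h1 := hX.increment_law 0 t zero_le
  -- The past up to time `0` contains `X 0`; evaluating it at index `0` gives independence.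
  have hind : IndepFun (X 0) (fun ω => X t ω - X 0 ω) P :=
    ((hX.increment_indep 0 t zero_le).comp measurable_id
      (measurable_pi_apply (⟨0, Set.self_mem_Iic⟩ : Set.Iic (0 : ℝ≥0)))).symm
  have hprod := hind.map_prod_eq_prod_map_map h0.aemeasurable h1.aemeasurable
  rw [h0.map_eq, h1.map_eq, NNReal.coe_zero, sub_zero] at hprod
  rw [← hprod, AEMeasurable.map_map_of_aemeasurable (by fun_prop)
    (h0.aemeasurable.prodMk h1.aemeasurable)]
  simp [Function.comp_def]

/-- Isotropic noise has independent `N(0, t)` coordinates in any orthonormal basis. The outer map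
discards the signal and reassembles the vector; it is the map used for data processing. -/
theorem map_add_multivariateGaussian_eq {d : ℕ} (μ : Measure (EuclideanSpace ℝ (Fin d)))
    [IsProbabilityMeasure μ] (b : OrthonormalBasis (Fin d) ℝ (EuclideanSpace ℝ (Fin d)))
    (t : ℝ≥0) :
    (μ.prod (multivariateGaussian 0 ((t : ℝ) • (1 : Matrix (Fin d) (Fin d) ℝ)))).map
        (fun p => p.1 + p.2) =
      ((μ.prod (Measure.pi fun _ : Fin d => gaussianReal 0 t)).map
        (fun p => (p.1, (fun i => ⟪b i, p.1⟫) + p.2))).map (fun p => ∑ i, p.2 i • b i) := by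
  have hγ := map_pi_gaussianReal_eq_multivariateGaussian b 0
    (S := (t : ℝ) • (1 : Matrix (Fin d) (Fin d) ℝ))
    (Matrix.PosSemidef.one.smul t.2) (v := fun _ => t) (fun k => by simp [Matrix.smul_mulVec])
  simp only [inner_zero_right] at hγ
  rw [← hγ]
  conv_lhs => rw [← Measure.map_id (μ := μ)]
  rw [Measure.map_prod_map _ _ measurable_id (by fun_prop), Measure.map_map (by fun_prop)
    (by fun_prop), Measure.map_map (by fun_prop) (by fun_prop)]
  congr 1
  ext1 p
  simp [add_smul, Finset.sum_add_distrib, b.sum_repr']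

end KLBrownian

theorem mainTheorem4 {d : ℕ} {Ω : Type*} [MeasurableSpace Ω] (P : Measure Ω)
    [IsProbabilityMeasure P]
    (μ_data : Measure (EuclideanSpace ℝ (Fin d))) [IsProbabilityMeasure μ_data]
    (hμ : MemLp (fun x => x) 2 μ_data)
    (X : ℝ≥0 → Ω → EuclideanSpace ℝ (Fin d))
    (hX : KLBrownian.IsBrownianMotionFrom X μ_data P)
    (T : ℝ≥0) (hT : 0 < T) :
    InformationTheory.klDiv (P.map (X T))
        (multivariateGaussian (∫ x, x ∂μ_data)
          (KLBrownian.covarianceMatrix μ_data + (T : ℝ) • (1 : Matrix (Fin d) (Fin d) ℝ)))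
      ≤ ENNReal.ofReal (1 / 2 * Real.log
          ((∏ i, (KLBrownian.covarianceEigenvalues μ_data i + (T : ℝ))) / (T : ℝ) ^ d)) := by
  set b := (KLBrownian.covarianceMatrix_isHermitian μ_data).eigenvectorBasis with hb
  have hc : ∀ i, 0 ≤ KLBrownian.covarianceEigenvalues μ_data i := fun i => by
    rw [← KLBrownian.variance_inner_eigenvectorBasis hμ]
    exact variance_nonneg _ _
  have hT' : (0 : ℝ) < T := hT
  let v : Fin d → ℝ≥0 := fun i =>
    ⟨KLBrownian.covarianceEigenvalues μ_data i, hc i⟩ + T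
  have hvc : ∀ i, (v i : ℝ) = KLBrownian.covarianceEigenvalues μ_data i + T := fun i => rfl
  have hmean : ∀ i, ∫ x, inner ℝ (b i) x ∂μ_data = inner ℝ (b i) (∫ x, x ∂μ_data) := fun i =>
    integral_inner (hμ.integrable (by norm_num)) _
  have hν := KLBrownian.map_pi_gaussianReal_eq_multivariateGaussian b (∫ x, x ∂μ_data)
    ((KLBrownian.covarianceMatrix_posSemidef hμ).add (Matrix.PosSemidef.one.smul hT'.le)) (v := v)
    (fun k => by
      rw [Matrix.add_mulVec, hb, Matrix.IsHermitian.mulVec_eigenvectorBasis, Matrix.smul_mulVec,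
        Matrix.one_mulVec, hvc, add_smul]
      rfl)
  -- The factor `μ_data` is a dummy, added so that the prior is an image under the same map as the
  -- law of `X T`.
  have hprior : multivariateGaussian (∫ x, x ∂μ_data)
      (KLBrownian.covarianceMatrix μ_data + (T : ℝ) • (1 : Matrix (Fin d) (Fin d) ℝ)) =
      (μ_data.prod (Measure.pi fun i => gaussianReal (∫ x, inner ℝ (b i) x ∂μ_data) (v i))).map
        (fun p => ∑ i, p.2 i • b i) := by
    simp_rw [hmean]
    rw [← hν]
    conv_lhs => rw [← Measure.snd_prod (μ := μ_data)
      (ν := Measure.pi fun i => gaussianReal (inner ℝ (b i) (∫ x, x ∂μ_data)) (v i))]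
    rw [Measure.snd, Measure.map_map (by fun_prop) measurable_snd]
    rfl
  rw [hX.map_eq_map_add, KLBrownian.map_add_multivariateGaussian_eq μ_data b, hprior]
  have : IsProbabilityMeasure ((μ_data.prod (Measure.pi fun _ : Fin d => gaussianReal 0 T)).map
      (fun p => (p.1, (fun i => inner ℝ (b i) p.1) + p.2))) :=
    Measure.isProbabilityMeasure_map (by fun_prop)
  refine (InformationTheory.klDiv_map_le _ _ (by fun_prop)).trans_eq ?_
  rw [KLBrownian.klDiv_map_prod_pi_gaussianReal μ_data (a := fun x i => inner ℝ (b i) x)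
    (by fun_prop) (fun i => hμ.const_inner (b i)) hT.ne' fun i => by
      rw [hvc, KLBrownian.variance_inner_eigenvectorBasis hμ]]
  congr 1
  rw [← Finset.mul_sum, ← Real.log_prod fun i _ => by
    have := hc i
    rw [hvc]
    positivity]
  simp [hvc, Finset.prod_div_distrib]
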